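/- Let $S$ be a normal band, i.e. a semigroup in which every element is idempotent and $abca=acba$ for all $a,b,c\in S$. Let $A=\ell^1(S)$ be its complex convolution algebra, with dual $A$-bimodule $A'$. For $n\ge 0$ let $C_n(A,A)$ be the completed projective tensor product of $n+1$ copies of $A$, and let $\mathsf d_n:C_{n+1}(A,A)\to C_n(A,A)$ be the Hochschild boundary operator, that is, the bounded linear map determined by \[ \mathsf d_n(a_0\otimes\cdots\otimes a_{n+1})=\sum_{i=0}^{n}(-1)^i\,a_0\otimes\cdots\otimes a_ia_{i+1}\otimes\cdots\otimes a_{n+1}+(-1)^{n+1}a_{n+1}a_0\otimes a_1\otimes\cdots\otimes a_n . \] Then $\ell^1(S)$ is simplicially trivial: for every $n\ge 1$, \[ H_n(A,A)=\ker \mathsf d_{n-1}/\operatorname{im}\mathsf d_n=0\qquad\text{and}\qquad H^n(A,A')=0, \] where $H^n(A,A')$ is the Hochschild cohomology computed with bounded $n$-linear maps $A^n\to A'$, $A'$ carrying the module structure $(b\cdot f)(x)=f(xb)$, $(f\cdot b)(x)=f(bx)$. -/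

import Mathlib

universe u

set_option maxSynthPendingDepth 3

/-- A normal band: a semigroup in which every element is idempotent and `abca = acba` holds. -/
structure IsNormalBand (S : Type u) [Semigroup S] : Prop where
  idem : ∀ a : S, a * a = a
  normal : ∀ a b c : S, a * b * c * a = a * c * b * a

/-! ### The convolution algebra of a semigroup -/

/-- The Banach space `ℓ¹(S)` of absolutely summable complex functions on `S`. -/
abbrev Ell1 (S : Type u) : Type u := lp (fun _ : S => ℂ) 1

namespace Ell1

variable {S : Type u}

theorem summable_norm (f : Ell1 S) : Summable fun s => ‖f s‖ := by
  simpa using (lp.memℓp f).summable (by simp)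

theorem norm_eq_tsum (f : Ell1 S) : ‖f‖ = ∑' s, ‖f s‖ := by
  simpa using lp.norm_eq_tsum_rpow (by simp) f

theorem summable_norm_prod (f g : Ell1 S) :
    Summable fun p : S × S => ‖f p.1 * g p.2‖ :=
  Summable.mul_norm (summable_norm f) (summable_norm g)

section Mul

variable [Mul S]

/-- The convolution `(f * g)(s) = ∑_{xy = s} f(x) g(y)`. -/
noncomputable def conv (f g : S → ℂ) (s : S) : ℂ :=
  ∑' p : {p : S × S // p.1 * p.2 = s}, f p.1.1 * g p.1.2

theorem summable_conv (f g : Ell1 S) (s : S) :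
    Summable fun p : {p : S × S // p.1 * p.2 = s} => f p.1.1 * g p.1.2 :=
  ((summable_norm_prod f g).subtype {p : S × S | p.1 * p.2 = s}).of_norm

theorem summable_norm_sigma (f g : Ell1 S) :
    Summable fun q : (Σ s : S, {p : S × S // p.1 * p.2 = s}) =>
      ‖f q.2.1.1 * g q.2.1.2‖ :=
  (Equiv.sigmaFiberEquiv fun p : S × S => p.1 * p.2).summable_iff.mpr (summable_norm_prod f g)

theorem norm_conv_le (f g : Ell1 S) (s : S) :
    ‖conv f g s‖ ≤ ∑' p : {p : S × S // p.1 * p.2 = s}, ‖f p.1.1 * g p.1.2‖ :=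
  norm_tsum_le_tsum_norm ((summable_norm_prod f g).subtype {p : S × S | p.1 * p.2 = s})

theorem summable_norm_conv (f g : Ell1 S) : Summable fun s => ‖conv f g s‖ :=
  Summable.of_nonneg_of_le (fun _ => norm_nonneg _) (norm_conv_le f g)
    (summable_norm_sigma f g).sigma

noncomputable instance : Mul (Ell1 S) :=
  ⟨fun f g => ⟨conv f g, memℓp_gen (by simpa using summable_norm_conv f g)⟩⟩

theorem mul_apply (f g : Ell1 S) (s : S) :
    (f * g) s = ∑' p : {p : S × S // p.1 * p.2 = s}, f p.1.1 * g p.1.2 := rfl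

protected theorem norm_mul_le (f g : Ell1 S) : ‖f * g‖ ≤ ‖f‖ * ‖g‖ := by
  have h : ∑' p : S × S, ‖f p.1 * g p.2‖ = ‖f‖ * ‖g‖ := by
    rw [norm_eq_tsum f, norm_eq_tsum g,
      tsum_mul_tsum_of_summable_norm (by simpa using summable_norm f)
        (by simpa using summable_norm g)]
    simp
  rw [norm_eq_tsum (f * g), ← h,
    ← (Equiv.sigmaFiberEquiv fun p : S × S => p.1 * p.2).tsum_eq]
  refine le_trans (Summable.tsum_le_tsum (norm_conv_le f g) (summable_norm_conv f g)
    (summable_norm_sigma f g).sigma) (le_of_eq ?_)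
  exact ((summable_norm_sigma f g).tsum_sigma' fun s => (summable_norm_sigma f g).sigma_factor s).symm

protected theorem add_mul (f g h : Ell1 S) : (f + g) * h = f * h + g * h := by
  ext s
  simp only [lp.coeFn_add, Pi.add_apply, mul_apply, _root_.add_mul]
  exact (summable_conv f h s).tsum_add (summable_conv g h s)

protected theorem mul_add (f g h : Ell1 S) : f * (g + h) = f * g + f * h := by
  ext s
  simp only [lp.coeFn_add, Pi.add_apply, mul_apply, _root_.mul_add]
  exact (summable_conv f g s).tsum_add (summable_conv f h s)

protected theorem smul_mul (c : ℂ) (f g : Ell1 S) : (c • f) * g = c • (f * g) := by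
  ext s
  simp only [lp.coeFn_smul, Pi.smul_apply, mul_apply, smul_eq_mul, mul_assoc]
  exact tsum_mul_left

protected theorem mul_smul (c : ℂ) (f g : Ell1 S) : f * (c • g) = c • (f * g) := by
  ext s
  simp only [lp.coeFn_smul, Pi.smul_apply, mul_apply, smul_eq_mul, mul_left_comm _ c]
  exact tsum_mul_left

/-- Convolution as a bounded bilinear map. -/
noncomputable def mulL : Ell1 S →L[ℂ] Ell1 S →L[ℂ] Ell1 S :=
  LinearMap.mkContinuous₂ (LinearMap.mk₂ ℂ (fun f g : Ell1 S => f * g) Ell1.add_mul Ell1.smul_mul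
    Ell1.mul_add Ell1.mul_smul) 1 fun f g => by simpa using Ell1.norm_mul_le f g

theorem mulL_apply (f g : Ell1 S) : mulL f g = f * g := rfl

open Classical in
theorem single_mul_single (x y : S) (a b : ℂ) :
    (lp.single 1 x a * lp.single 1 y b : Ell1 S) = lp.single 1 (x * y) (a * b) := by
  ext s
  rw [mul_apply]
  by_cases hs : x * y = s
  · subst hs
    rw [tsum_eq_single (⟨(x, y), rfl⟩ : {p : S × S // p.1 * p.2 = x * y})]
    · simp
    · rintro ⟨⟨x', y'⟩, h'⟩ hne
      by_cases hx : x' = x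
      · have hy : y' ≠ y := fun hy => hne (by subst hx hy; rfl)
        simp [hy]
      · simp [hx]
  · rw [lp.single_apply_ne _ _ _ (Ne.symm hs)]
    refine (tsum_congr ?_).trans tsum_zero
    rintro ⟨⟨x', y'⟩, h'⟩
    by_cases hx : x' = x
    · have hy : y' ≠ y := fun hy => hs (by subst hx hy; exact h')
      simp [hy]
    · simp [hx]

end Mul

open Classical in
theorem clm_ext {E : Type*} [NormedAddCommGroup E] [NormedSpace ℂ E] {L M : Ell1 S →L[ℂ] E}
    (h : ∀ s a, L (lp.single 1 s a) = M (lp.single 1 s a)) (f : Ell1 S) : L f = M f := by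
  have hf := lp.hasSum_single (p := 1) (by simp) f
  have h1 := L.hasSum hf
  have h2 := M.hasSum hf
  simp only [h] at h1
  exact h1.unique h2

protected theorem mul_assoc [Semigroup S] (f g h : Ell1 S) : f * g * h = f * (g * h) := by
  classical
  refine clm_ext (L := (mulL.flip h).comp (mulL.flip g)) (M := mulL.flip (g * h)) (fun x a => ?_) f
  refine clm_ext (L := (mulL.flip h).comp (mulL (lp.single 1 x a)))
    (M := (mulL (lp.single 1 x a)).comp (mulL.flip h)) (fun y b => ?_) g
  refine clm_ext (L := mulL (lp.single 1 x a * lp.single 1 y b))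
    (M := (mulL (lp.single 1 x a)).comp (mulL (lp.single 1 y b))) (fun z c => ?_) h
  simp only [mulL_apply, ContinuousLinearMap.comp_apply, single_mul_single, mul_assoc]

/-- `ℓ¹(S)` with convolution is a (not necessarily unital) Banach algebra. -/
noncomputable instance [Semigroup S] : NonUnitalNormedRing (Ell1 S) where
  __ := (inferInstance : NormedAddCommGroup (Ell1 S))
  mul := (· * ·)
  left_distrib := Ell1.mul_add
  right_distrib := Ell1.add_mul
  zero_mul f := by simpa using Ell1.smul_mul 0 0 f
  mul_zero f := by simpa using Ell1.mul_smul 0 f 0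
  mul_assoc := Ell1.mul_assoc
  norm_mul_le := Ell1.norm_mul_le

instance [Semigroup S] : IsScalarTower ℂ (Ell1 S) (Ell1 S) := ⟨Ell1.smul_mul⟩

instance [Semigroup S] : SMulCommClass ℂ (Ell1 S) (Ell1 S) :=
  ⟨fun c f g => (Ell1.mul_smul c f g).symm⟩

end Ell1

/-! ### The simplicial chain complex of a Banach algebra -/

namespace Hochschild

section Faces

variable {A : Type u}

/-- The `i`-th face of `(a₀, …, aₙ₊₁)`: for `i ≤ n` the entries `aᵢ` and `aᵢ₊₁` are multiplied
together, and for `i = n + 1` the result is `(aₙ₊₁ a₀, a₁, …, aₙ)`. -/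
def face [Mul A] {n : ℕ} (i : Fin (n + 2)) (a : Fin (n + 2) → A) : Fin (n + 1) → A :=
  if i = Fin.last (n + 1) then
    Function.update (Fin.init a) 0 (a (Fin.last (n + 1)) * a 0)
  else i.contractNth (· * ·) a

theorem continuous_face [NonUnitalNormedRing A] {n : ℕ} (i : Fin (n + 2)) :
    Continuous (face i : (Fin (n + 2) → A) → Fin (n + 1) → A) := by
  unfold face
  split_ifs
  · unfold Fin.init
    fun_prop
  · refine continuous_pi fun k => ?_
    unfold Fin.contractNth
    split_ifs <;> fun_prop

variable [NonUnitalNormedRing A] [NormedSpace ℂ A] [IsScalarTower ℂ A A] [SMulCommClass ℂ A A]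

/-- Changing one entry of a tuple changes one entry of each face, in a linear way. -/
theorem face_update {n : ℕ} (i : Fin (n + 2)) (a : Fin (n + 2) → A) (k : Fin (n + 2)) :
    ∃ (j : Fin (n + 1)) (l : A →ₗ[ℂ] A), ∀ x,
      face i (Function.update a k x) = Function.update (face i a) j (l x) := by
  by_cases hi : i = Fin.last (n + 1)
  · subst hi
    have h0 : (0 : Fin (n + 2)) ≠ Fin.last (n + 1) := (Fin.last_pos).ne
    rcases Fin.eq_castSucc_or_eq_last k with ⟨j, rfl⟩ | rfl
    · by_cases hj : j = 0
      · subst hj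
        refine ⟨0, LinearMap.mulLeft ℂ (a (Fin.last (n + 1))), fun x => ?_⟩
        funext m
        by_cases hm : m = 0
        · subst hm
          simp [face, h0.symm]
        · have : m.castSucc ≠ 0 := by simpa using hm
          simp [face, hm, Fin.init, this]
      · refine ⟨j, LinearMap.id, fun x => ?_⟩
        have hj' : (0 : Fin (n + 2)) ≠ j.castSucc := by
          intro h; exact hj (by ext; simpa using (congrArg Fin.val h).symm)
        have hl : Fin.last (n + 1) ≠ j.castSucc := (Fin.castSucc_lt_last j).ne'
        funext m
        by_cases hm : m = 0
        · subst hm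
          simp [face, hj', hl, Ne.symm hj]
        · by_cases hmj : m = j
          · subst hmj
            simp [face, hm]
          · simp [face, hm, hmj, Fin.init]
    · refine ⟨0, LinearMap.mulRight ℂ (a 0), fun x => ?_⟩
      funext m
      by_cases hm : m = 0
      · subst hm
        simp [face, h0]
      · simp [face, hm, Fin.init]
  · have hin : (i : ℕ) < n + 1 := Fin.val_lt_last hi
    have key : ∀ (j : Fin (n + 1)) (l : A →ₗ[ℂ] A),
        (∀ x m, m ≠ j → i.contractNth (· * ·) (Function.update a k x) m =
          i.contractNth (· * ·) a m) →
        (∀ x, i.contractNth (· * ·) (Function.update a k x) j = l x) →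
        ∃ (j : Fin (n + 1)) (l : A →ₗ[ℂ] A), ∀ x,
          face i (Function.update a k x) = Function.update (face i a) j (l x) := by
      intro j l h1 h2
      refine ⟨j, l, fun x => ?_⟩
      funext m
      simp only [face, if_neg hi]
      by_cases hm : m = j
      · subst hm
        simp [h2]
      · simp [hm, h1]
    rcases lt_trichotomy (k : ℕ) (i : ℕ) with hk | hk | hk
    · refine key ⟨k, by omega⟩ LinearMap.id (fun x m hm => ?_) (fun x => ?_)
      all_goals
        clear key
        simp only [Fin.contractNth, Function.update_apply, Fin.ext_iff, Fin.val_castSucc,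
          Fin.val_succ, ne_eq, LinearMap.id_apply] at *
        grind
    · refine key ⟨k, by omega⟩ (LinearMap.mulRight ℂ (a (Fin.succ ⟨i, hin⟩)))
        (fun x m hm => ?_) (fun x => ?_)
      all_goals
        clear key
        simp only [Fin.contractNth, Function.update_apply, Fin.ext_iff, Fin.val_castSucc,
          Fin.val_succ, ne_eq, LinearMap.mulRight_apply] at *
        grind
    · by_cases hk1 : (k : ℕ) = i + 1
      · refine key ⟨i, hin⟩ (LinearMap.mulLeft ℂ (a (Fin.castSucc ⟨i, hin⟩)))
          (fun x m hm => ?_) (fun x => ?_)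
        all_goals
          clear key
          simp only [Fin.contractNth, Function.update_apply, Fin.ext_iff, Fin.val_castSucc,
            Fin.val_succ, ne_eq, LinearMap.mulLeft_apply] at *
          grind
      · refine key ⟨k - 1, by omega⟩ LinearMap.id (fun x m hm => ?_) (fun x => ?_)
        all_goals
          clear key
          simp only [Fin.contractNth, Function.update_apply, Fin.ext_iff, Fin.val_castSucc,
            Fin.val_succ, ne_eq, LinearMap.id_apply] at *
          grind

/-- The bounded multilinear map `(a₀, …, aₙ₊₁) ↦ ∂ᵢ(a₀ ⊗ ⋯ ⊗ aₙ₊₁)` into the tensor product of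
`n + 1` copies of `A`. -/
noncomputable def faceMultilinear (n : ℕ) (i : Fin (n + 2)) :
    ContinuousMultilinearMap ℂ (fun _ : Fin (n + 2) => A)
      (PiTensorProduct ℂ fun _ : Fin (n + 1) => A) where
  toFun a := PiTensorProduct.tprod ℂ (face i a)
  map_update_add' {inst} a k x y := by
    obtain rfl : inst = instDecidableEqFin _ := Subsingleton.elim _ _
    obtain ⟨j, l, h⟩ := face_update i a k
    simp [h]
  map_update_smul' {inst} a k c x := by
    obtain rfl : inst = instDecidableEqFin _ := Subsingleton.elim _ _
    obtain ⟨j, l, h⟩ := face_update i a k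
    simp [h]
  cont := by
    have h : Continuous fun a : Fin (n + 1) → A => PiTensorProduct.tprodL ℂ a :=
      (PiTensorProduct.tprodL ℂ).cont
    have h' := h.comp (continuous_face i)
    simpa [Function.comp_def] using h'

end Faces

variable (A : Type u) [NonUnitalNormedRing A] [NormedSpace ℂ A] [IsScalarTower ℂ A A]
  [SMulCommClass ℂ A A]

/-- The space `Cₙ(A, A)` of simplicial `n`-chains, the completed projective tensor product of
`n + 1` copies of `A`. (Mathlib's norm on `PiTensorProduct` is the projective one.) -/
abbrev Chain (n : ℕ) : Type u :=
  UniformSpace.Completion (PiTensorProduct ℂ fun _ : Fin (n + 1) => A)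

/-- The face map `∂ᵢ : Cₙ₊₁(A, A) → Cₙ(A, A)`. -/
noncomputable def faceMap (n : ℕ) (i : Fin (n + 2)) : Chain A (n + 1) →L[ℂ] Chain A n :=
  (PiTensorProduct.liftIsometry ℂ (fun _ : Fin (n + 2) => A) _ (faceMultilinear n i)).completion

/-- The boundary operator `dₙ = ∑ᵢ (-1)ⁱ ∂ᵢ : Cₙ₊₁(A, A) → Cₙ(A, A)`. -/
noncomputable def d (n : ℕ) : Chain A (n + 1) →L[ℂ] Chain A n :=
  ∑ i : Fin (n + 2), (-1 : ℂ) ^ (i : ℕ) • faceMap A n i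

/-- The space `Zₙ(A, A)` of simplicial `n`-cycles. -/
noncomputable def cycles : (n : ℕ) → Submodule ℂ (Chain A n)
  | 0 => ⊤
  | n + 1 => (d A n).ker

/-- The space `Bₙ(A, A)` of simplicial `n`-boundaries. -/
noncomputable def boundaries (n : ℕ) : Submodule ℂ (Chain A n) := (d A n).range

/-- The simplicial homology group `Hₙ(A, A) = Zₙ(A, A) / Bₙ(A, A)`. -/
abbrev Homology (n : ℕ) : Type u := cycles A n ⧸ (boundaries A n).submoduleOf (cycles A n)

/-! ### Simplicial cohomology, with coefficients in the dual bimodule -/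

/-- The space `Cⁿ(A, A')` of bounded `n`-linear maps from `A` to its dual `A'`. -/
abbrev Cochain (n : ℕ) : Type u :=
  ContinuousMultilinearMap ℂ (fun _ : Fin n => A) (StrongDual ℂ A)

variable {A}

/-- The value at `x` of the Hochschild coboundary `(δT)(a₀, …, aₙ) ∈ A'`, where `A'` has the
bimodule structure `(b · f)(x) = f(xb)`, `(f · b)(x) = f(bx)`. -/
noncomputable def coboundary {n : ℕ} (T : Cochain A n) (a : Fin (n + 1) → A) (x : A) : ℂ :=
  T (Fin.tail a) (x * a 0)
    + ∑ j : Fin n, (-1 : ℂ) ^ ((j : ℕ) + 1) * T (j.castSucc.contractNth (· * ·) a) x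
    + (-1 : ℂ) ^ (n + 1) * T (Fin.init a) (a (Fin.last n) * x)

theorem coboundary_add {n : ℕ} (T U : Cochain A n) (a : Fin (n + 1) → A) (x : A) :
    coboundary (T + U) a x = coboundary T a x + coboundary U a x := by
  simp only [coboundary, add_apply,
    mul_add, Finset.sum_add_distrib]
  ring

theorem coboundary_smul {n : ℕ} (c : ℂ) (T : Cochain A n) (a : Fin (n + 1) → A) (x : A) :
    coboundary (c • T) a x = c * coboundary T a x := by
  simp only [coboundary, smul_apply,
    smul_eq_mul, mul_add, Finset.mul_sum, mul_left_comm c]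

variable (A)

/-- The space `Zⁿ(A, A')` of simplicial `n`-cocycles. -/
noncomputable def cocycles (n : ℕ) : Submodule ℂ (Cochain A n) where
  carrier := {T | ∀ a x, coboundary T a x = 0}
  zero_mem' a x := by simp [coboundary]
  add_mem' {T U} hT hU a x := by rw [coboundary_add, hT, hU, add_zero]
  smul_mem' c T hT a x := by rw [coboundary_smul, hT, mul_zero]

/-- The space `Bⁿ(A, A')` of simplicial `n`-coboundaries. -/
noncomputable def coboundaries : (n : ℕ) → Submodule ℂ (Cochain A n)
  | 0 => ⊥
  | n + 1 =>
    { carrier := {T | ∃ U : Cochain A n, ∀ a x, T a x = coboundary U a x}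
      zero_mem' := ⟨0, fun a x => by simp [coboundary]⟩
      add_mem' := by
        rintro T T' ⟨U, hU⟩ ⟨U', hU'⟩
        refine ⟨U + U', fun a x => ?_⟩
        rw [coboundary_add, ← hU, ← hU']
        rfl
      smul_mem' := by
        rintro c T ⟨U, hU⟩
        refine ⟨c • U, fun a x => ?_⟩
        rw [coboundary_smul, ← hU]
        rfl }

/-- The simplicial cohomology group `Hⁿ(A, A') = Zⁿ(A, A') / Bⁿ(A, A')`. -/
abbrev Cohomology (n : ℕ) : Type u :=
  cocycles A n ⧸ (coboundaries A n).submoduleOf (cocycles A n)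

/-- `A` is simplicially trivial if `Hₙ(A, A) = 0` and `Hⁿ(A, A') = 0` for all `n ≥ 1`. -/
def SimpliciallyTrivial : Prop :=
  ∀ n : ℕ, 1 ≤ n → Subsingleton (Homology A n) ∧ Subsingleton (Cohomology A n)

end Hochschild

namespace Hochschild

/-! ### Faces of tuples -/

section FaceCombinatorics

/-! The plan is a bounded contraction of the chain complex in positive degrees: operators `H n` with
`d H + H d = id` on every `Chain (Ell1 S) (n + 1)` (`exists_contraction`). Homology vanishes at
once, and cohomology by composing a cocycle, read as a functional on chains, with `H`. Since bounded
functions on tuples of `S` extend to bounded operators on chains, it is enough to define the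
contraction on tuples, with finitely supported values whose norms are bounded in terms of the degree
only.

A normal band is a semilattice of rectangular bands. Multiplying a tuple into the component of its
total product `m`, by the endomorphism `s ↦ s * m * s`, commutes with all faces, because a face does
not change that component (`retract_face`). In a single rectangular band an element `e` splits the
multiplication by `x ↦ x e ⊗ e x`, and this contracts the retracted tuples (`algD_rectHomotopy`).

It remains to join the identity to the retraction by a homotopy, which is done by acyclic models.
Every `(n + 1)`-tuple is the image of the generators of the free normal band on `n + 1` letters.
This band is finite, and Möbius inversion over supports gives a bimodule section of its
multiplication (`mulSection`), so cycles of positive degree there are boundaries. One universal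
chain per degree is chosen inductively and pushed forward along `eval`. Its `ℓ¹` norm does not grow
under the push, which gives the uniform bound. -/

theorem face_apply {X : Type*} [Mul X] {n : ℕ} (i : Fin (n + 2)) (a : Fin (n + 2) → X)
    (k : Fin (n + 1)) :
    face i a k =
      if (i : ℕ) = n + 1 then
        (if (k : ℕ) = 0 then a (Fin.last (n + 1)) * a 0 else a k.castSucc)
      else if (k : ℕ) < i then a k.castSucc
      else if (k : ℕ) = i then a k.castSucc * a k.succ else a k.succ := by
  unfold face
  by_cases hi : i = Fin.last (n + 1)
  · subst hi
    by_cases hk : k = 0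
    · subst hk; simp
    · simp [hk, Fin.init]
  · have : (i : ℕ) ≠ n + 1 := fun h => hi (Fin.ext h)
    simp [hi, this, Fin.contractNth]

theorem comp_face {X Y : Type*} [Mul X] [Mul Y] (f : X →ₙ* Y) {n : ℕ} (i : Fin (n + 2))
    (a : Fin (n + 2) → X) : f ∘ face i a = face i (f ∘ a) := by
  funext k
  simp only [Function.comp_apply, face_apply]
  split_ifs <;> simp

/-- The simplicial identity for faces. -/
theorem face_face {X : Type*} [Semigroup X] {n : ℕ} {i j : Fin (n + 2)} (h : i ≤ j)
    (a : Fin (n + 3) → X) : face i (face j.succ a) = face j (face i.castSucc a) := by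
  funext k
  have hi := i.isLt
  have hj := j.isLt
  have hk := k.isLt
  have h' : (i : ℕ) ≤ j := h
  -- Indexing by `ℕ` reduces the identity to comparing natural numbers; the value `a 0` out of range
  -- is never used.
  obtain ⟨b, hb⟩ : ∃ b : ℕ → X, ∀ k, a k = b k :=
    ⟨fun m => if h : m < n + 3 then a ⟨m, h⟩ else a 0, fun k => by simp⟩
  simp only [face_apply, hb, Fin.val_succ, Fin.val_castSucc, Fin.val_last, Fin.val_zero]
  clear hb
  have := @mul_assoc X _
  grind

/-- Every entry of a tuple divides an entry of each face, and entries of faces are entries or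
products of two entries: a predicate compatible with products holds on all entries of a tuple if
and only if it does on a face. -/
theorem forall_face_iff {X : Type*} [Mul X] {p : X → Prop} (hp : ∀ x y, p (x * y) ↔ p x ∧ p y)
    {n : ℕ} (i : Fin (n + 2)) (a : Fin (n + 2) → X) :
    (∀ k, p (face i a k)) ↔ ∀ k, p (a k) := by
  have hi := i.isLt
  constructor
  · intro h k
    by_cases hl : (i : ℕ) = n + 1
    · rcases Fin.eq_castSucc_or_eq_last k with ⟨j, rfl⟩ | rfl
      · have := h j
        simp only [face_apply, hl, if_true] at this
        split_ifs at this with h0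
        · obtain rfl : j = 0 := Fin.ext h0
          exact ((hp _ _).1 this).2
        · exact this
      · have := h 0
        simp only [face_apply, hl, if_true] at this
        exact ((hp _ _).1 (by simpa using this)).1
    · rcases lt_or_ge (i : ℕ) k with hik | hik
      · have hk : k ≠ 0 := by rintro rfl; simp at hik
        obtain ⟨j, rfl⟩ := Fin.exists_succ_eq.2 hk
        have := h j
        simp only [Fin.val_succ] at hik
        simp only [face_apply, hl, if_false, show ¬ (j : ℕ) < i by omega] at this
        split_ifs at this
        · exact ((hp _ _).1 this).2
        · exact this
      · have hk : k ≠ Fin.last (n + 1) := by rintro rfl; simp at hik; omega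
        obtain ⟨j, rfl⟩ := Fin.exists_castSucc_eq.2 hk
        have := h j
        simp only [Fin.val_castSucc] at hik
        simp only [face_apply, hl, if_false] at this
        split_ifs at this
        · exact this
        · exact ((hp _ _).1 this).1
        · omega
  · intro h k
    rw [face_apply]
    split_ifs <;> simp [hp, h]

/-- The tuple `(l, r, b₁, …, bₙ)`. -/
def splitHead {X : Type*} {n : ℕ} (l r : X) (b : Fin (n + 1) → X) : Fin (n + 2) → X :=
  Fin.cons l (Fin.cons r (Fin.tail b))

theorem splitHead_apply {X : Type*} {n : ℕ} (l r : X) (b : Fin (n + 1) → X) (k : Fin (n + 2)) :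
    splitHead l r b k =
      if _ : (k : ℕ) = 0 then l else if (k : ℕ) = 1 then r else b ⟨k - 1, by omega⟩ := by
  refine Fin.cases ?_ (fun k => ?_) k
  · simp [splitHead]
  · refine Fin.cases ?_ (fun k => ?_) k
    · simp [splitHead]
    · simp only [splitHead, Fin.cons_succ, Fin.tail, Fin.val_succ]
      simp [Fin.succ]

theorem face_zero_splitHead {X : Type*} [Mul X] {n : ℕ} (l r : X) (b : Fin (n + 1) → X) :
    face 0 (splitHead l r b) = Fin.cons (l * r) (Fin.tail b) := by
  funext k
  refine Fin.cases ?_ (fun k => ?_) k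
  · simp [face_apply, splitHead]
  · simp [face_apply, splitHead, -Fin.castSucc_succ]

theorem face_succ_splitHead {X : Type*} [Mul X] {n : ℕ} (i : Fin (n + 2)) (l r : X)
    (b : Fin (n + 2) → X) :
    face i.succ (splitHead l r b) =
      if i = 0 then splitHead l (r * b 1) (face 0 b)
      else if i = Fin.last _ then splitHead (b (Fin.last _) * l) r (face i b)
      else splitHead l r (face i b) := by
  funext k
  have hk := k.isLt
  have hi := i.isLt
  obtain ⟨c, hc⟩ : ∃ c : ℕ → X, ∀ k, b k = c k :=
    ⟨fun m => if h : m < n + 2 then b ⟨m, h⟩ else b 0, fun k => by simp⟩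
  split_ifs with h1 h2
  all_goals
    simp only [Fin.ext_iff, Fin.val_zero, Fin.val_last] at *
    simp only [face_apply, splitHead_apply, Fin.val_succ, Fin.val_castSucc, Fin.val_last,
      Fin.val_zero, Fin.val_one, hc]
    clear hc
    grind

end FaceCombinatorics

end Hochschild

namespace Hochschild

/-! ### The algebraic chain complex -/

/-- The bijection `(i, j) ↦ (j, i + 1)` from the pairs with `j ≤ i` to those with `i < j` preserves
`G` and reverses the sign. -/
theorem sum_alternating_eq_zero {V : Type*} [AddCommGroup V] [Module ℂ V] {n : ℕ}
    (G : Fin (n + 2) → Fin (n + 3) → V) (hG : ∀ i j, i ≤ j → G i j.succ = G j i.castSucc) :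
    ∑ j : Fin (n + 3), (-1 : ℂ) ^ (j : ℕ) • ∑ i : Fin (n + 2), (-1 : ℂ) ^ (i : ℕ) • G i j = 0 := by
  simp only [Finset.smul_sum, smul_smul]
  rw [Finset.sum_comm]
  simp only [← Finset.sum_product']
  let S : Finset (Fin (n + 2) × Fin (n + 3)) := {ij | (ij.2 : ℕ) ≤ (ij.1 : ℕ)}
  rw [Finset.univ_product_univ, ← Finset.sum_add_sum_compl S, ← eq_neg_iff_add_eq_zero,
    ← Finset.sum_neg_distrib]
  let φ : ∀ ij : Fin (n + 2) × Fin (n + 3), ij ∈ S → Fin (n + 2) × Fin (n + 3) := fun ij hij =>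
    (Fin.castLT ij.2 (lt_of_le_of_lt (Finset.mem_filter.mp hij).right (Fin.is_lt ij.1)), ij.1.succ)
  apply Finset.sum_bij φ
  · intro ij hij
    simp_rw [S, φ, Finset.compl_filter, Finset.mem_filter_univ, Fin.val_succ,
      Fin.val_castLT] at hij ⊢
    lia
  · rintro ⟨i, j⟩ hij ⟨i', j'⟩ hij' h
    rw [Prod.mk_inj]
    exact ⟨by simpa [φ] using! congr_arg Prod.snd h,
      by simpa [φ, Fin.castSucc_castLT] using! congr_arg Fin.castSucc (congr_arg Prod.fst h)⟩
  · rintro ⟨i', j'⟩ hij'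
    simp_rw [S, Finset.compl_filter, Finset.mem_filter_univ, not_le] at hij'
    refine ⟨(j'.pred <| ?_, Fin.castSucc i'), ?_, ?_⟩
    · rintro rfl
      simp only [Fin.val_zero, not_lt_zero] at hij'
    · simpa [S] using! Nat.le_sub_one_of_lt hij'
    · simp only [φ, Fin.castLT_castSucc, Fin.succ_pred]
  · rintro ⟨i, j⟩ hij
    have hij' : (j : ℕ) ≤ i := by simpa [S] using! hij
    have := hG (j.castLT (lt_of_le_of_lt hij' i.isLt)) i hij'
    simp only [Fin.castSucc_castLT] at this
    simp only [φ, this, ← neg_smul, Fin.val_succ, Fin.val_castLT]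
    congr 1
    ring

variable {X : Type*}

/-- The free vector space on the `(n + 1)`-tuples of elements of `X`. -/
abbrev AlgChain (X : Type*) (n : ℕ) : Type _ := (Fin (n + 1) → X) →₀ ℂ

/-- The boundary operator on finitely supported chains. -/
noncomputable def algD (X : Type*) [Mul X] (n : ℕ) : AlgChain X (n + 1) →ₗ[ℂ] AlgChain X n :=
  ∑ i : Fin (n + 2), (-1 : ℂ) ^ (i : ℕ) • Finsupp.lmapDomain ℂ ℂ (face i)

theorem algD_apply [Mul X] {n : ℕ} (z : AlgChain X (n + 1)) :
    algD X n z = ∑ i : Fin (n + 2), (-1 : ℂ) ^ (i : ℕ) • z.mapDomain (face i) := by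
  simp [algD]

theorem algD_single [Mul X] {n : ℕ} (a : Fin (n + 2) → X) :
    algD X n (Finsupp.single a 1) =
      ∑ i : Fin (n + 2), (-1 : ℂ) ^ (i : ℕ) • Finsupp.single (face i a) 1 := by
  simp [algD_apply]

theorem algD_algD [Semigroup X] {n : ℕ} (z : AlgChain X (n + 2)) :
    algD X n (algD X (n + 1) z) = 0 := by
  rw [algD_apply z]
  simp only [map_sum, map_smul, algD_apply, ← Finsupp.mapDomain_comp]
  refine sum_alternating_eq_zero (fun i j => z.mapDomain (face i ∘ face j)) fun i j h => ?_
  congr 1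
  funext a
  exact face_face h a

/-- The map on chains induced by a map `f`. -/
noncomputable def push {X Y : Type*} (f : X → Y) (n : ℕ) : AlgChain X n →ₗ[ℂ] AlgChain Y n :=
  Finsupp.lmapDomain ℂ ℂ (f ∘ ·)

theorem push_apply {X Y : Type*} (f : X → Y) {n : ℕ} (z : AlgChain X n) :
    push f n z = z.mapDomain (f ∘ ·) := rfl

theorem push_single {X Y : Type*} (f : X → Y) {n : ℕ} (a : Fin (n + 1) → X) (c : ℂ) :
    push f n (Finsupp.single a c) = Finsupp.single (f ∘ a) c := by
  simp [push_apply]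

theorem push_push {X Y Z : Type*} (g : Y → Z) (f : X → Y) {n : ℕ} (z : AlgChain X n) :
    push g n (push f n z) = push (g ∘ f) n z := by
  simp only [push_apply, ← Finsupp.mapDomain_comp]
  rfl

theorem algD_push {X Y : Type*} [Mul X] [Mul Y] (f : X →ₙ* Y) {n : ℕ} (z : AlgChain X (n + 1)) :
    algD Y n (push f (n + 1) z) = push f n (algD X n z) := by
  rw [algD_apply z]
  simp only [map_sum, map_smul, algD_apply, push_apply, ← Finsupp.mapDomain_comp]
  refine Finset.sum_congr rfl fun i _ => ?_
  congr 2
  funext a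
  exact (comp_face f i a).symm

/-- The linear extension of a map defined on tuples. -/
noncomputable abbrev linExt {ι V : Type*} [AddCommGroup V] [Module ℂ V] (h : ι → V) :
    (ι →₀ ℂ) →ₗ[ℂ] V :=
  Finsupp.linearCombination ℂ h

/-- Splitting the first entry of a tuple by means of a map `X → ℂ[X × X]`. -/
noncomputable def split (Δ : X → (X × X) →₀ ℂ) {n : ℕ} (b : Fin (n + 1) → X) :
    AlgChain X (n + 1) :=
  (Δ (b 0)).mapDomain fun q => splitHead q.1 q.2 b

/-- If `Δ` is a bimodule section of the multiplication, then `split Δ` is a contraction. -/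
theorem algD_split [Mul X] (Δ : X → (X × X) →₀ ℂ) {n : ℕ} (b : Fin (n + 2) → X)
    (h0 : (Δ (b 0)).mapDomain (fun q => q.1 * q.2) = Finsupp.single (b 0) 1)
    (h1 : (Δ (b 0)).mapDomain (fun q => (q.1, q.2 * b 1)) = Δ (b 0 * b 1))
    (h2 : (Δ (b 0)).mapDomain (fun q => (b (Fin.last _) * q.1, q.2)) =
      Δ (b (Fin.last _) * b 0)) :
    algD X (n + 1) (split Δ b) = Finsupp.single b 1 -
      linExt (split Δ) (algD X n (Finsupp.single b 1)) := by
  have hz : (Δ (b 0)).mapDomain (face 0 ∘ fun q => splitHead q.1 q.2 b) = Finsupp.single b 1 := by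
    have : (face 0 ∘ fun q : X × X => splitHead q.1 q.2 b) =
        (fun x => Fin.cons x (Fin.tail b) : X → Fin (n + 2) → X) ∘ fun q => q.1 * q.2 := by
      funext q
      exact face_zero_splitHead q.1 q.2 b
    rw [this, Finsupp.mapDomain_comp, h0, Finsupp.mapDomain_single, Fin.cons_self_tail]
  -- Splitting shifts face indices by one, hence the minus sign in the result. `h1` serves the face
  -- `i = 0`, which alters the right half of the split entry, and `h2` the cyclic face, which alters
  -- the left half.
  have hs : ∀ i : Fin (n + 2), (Δ (b 0)).mapDomain (face i.succ ∘ fun q => splitHead q.1 q.2 b) =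
      split Δ (face i b) := by
    intro i
    have e : (face i.succ ∘ fun q : X × X => splitHead q.1 q.2 b) = fun q =>
        if i = 0 then splitHead q.1 (q.2 * b 1) (face 0 b)
        else if i = Fin.last _ then splitHead (b (Fin.last _) * q.1) q.2 (face i b)
        else splitHead q.1 q.2 (face i b) := by
      funext q
      exact face_succ_splitHead i q.1 q.2 b
    have hf : face i b 0 = if i = 0 then b 0 * b 1 else if i = Fin.last _ then
        b (Fin.last _) * b 0 else b 0 := by
      rw [face_apply]
      by_cases h : i = 0
      · subst h; simp
      · have : (i : ℕ) ≠ 0 := fun h' => h (Fin.ext h')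
        have h3 : i = Fin.last _ ↔ (i : ℕ) = n + 1 := Fin.ext_iff
        simp [h, h3, Nat.pos_of_ne_zero this]
    rw [e, split, hf]
    split_ifs with h h'
    · rw [← h1, ← Finsupp.mapDomain_comp, h]
      rfl
    · rw [← h2, ← Finsupp.mapDomain_comp]
      rfl
    · rfl
  rw [algD_apply, Fin.sum_univ_succ, algD_single, map_sum]
  simp only [split, ← Finsupp.mapDomain_comp] at hs ⊢
  simp only [hz, hs, map_smul, Finsupp.linearCombination_single, Fin.val_succ, pow_succ, one_smul,
    Fin.val_zero, pow_zero, mul_neg, mul_one, neg_smul, Finset.sum_neg_distrib, sub_eq_add_neg]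
  rfl

end Hochschild

/-! ### Normal bands -/

namespace IsNormalBand

variable {S : Type*} [Semigroup S]

/-- With equal outer factors the inner ones can be permuted (`key`). In general, squaring `x * y * z
* w` exhibits the overlapping pieces `x y z w x` and `w x y z w`, to which that case applies in
turn. -/
theorem mul_mul_mul_comm' (hS : IsNormalBand S) (x y z w : S) : x * y * z * w = x * z * y * w := by
  have key : ∀ x y z u : S, x * y * z * u * x = x * z * y * u * x := by
    intro x y z u
    calc x * y * z * u * x = x * y * (z * u) * x := by simp only [mul_assoc]
      _ = x * (z * u) * y * x := hS.normal _ _ _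
      _ = x * z * (u * y) * x := by simp only [mul_assoc]
      _ = x * (u * y) * z * x := hS.normal _ _ _
      _ = x * u * (y * z) * x := by simp only [mul_assoc]
      _ = x * (y * z) * u * x := hS.normal _ _ _
      _ = x * (y * z) * (u * x) * x := by simp only [mul_assoc, hS.idem]
      _ = x * (u * x) * (y * z) * x := hS.normal _ _ _
      _ = x * u * (x * y * z * x) := by simp only [mul_assoc]
      _ = x * u * (x * z * y * x) := by rw [hS.normal x y z]
      _ = x * (u * x) * (z * y) * x := by simp only [mul_assoc]
      _ = x * (z * y) * (u * x) * x := hS.normal _ _ _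
      _ = x * z * y * u * (x * x) := by simp only [mul_assoc]
      _ = x * z * y * u * x := by rw [hS.idem]
  calc x * y * z * w = (x * y * z * w) * (x * y * z * w) := (hS.idem _).symm
    _ = (x * y * z * w * x) * (y * z * w) := by simp only [mul_assoc]
    _ = x * z * y * (w * x * y * z * w) := by rw [key]; simp only [mul_assoc]
    _ = x * z * y * (w * x * z * y * w) := by
      congr 1
      have := key w y z w
      calc w * x * y * z * w = w * x * (y * z) * w := by simp only [mul_assoc]
        _ = w * (y * z) * x * w := hS.normal _ _ _
        _ = w * y * z * x * w := by simp only [mul_assoc]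
        _ = w * z * y * x * w := key _ _ _ _
        _ = w * (z * y) * x * w := by simp only [mul_assoc]
        _ = w * x * (z * y) * w := hS.normal _ _ _
        _ = w * x * z * y * w := by simp only [mul_assoc]
    _ = (x * z * y * w) * (x * z * y * w) := by simp only [mul_assoc]
    _ = x * z * y * w := hS.idem _

end IsNormalBand

namespace NormalBand

variable {S : Type*} [Semigroup S]

/-- The elements below `m` in the structure semilattice. -/
def below (m : S) : Set S := {x | x * m * x = x}

theorem mem_below {m x : S} : x ∈ below m ↔ x * m * x = x := Iff.rfl

theorem self_mem_below (hS : IsNormalBand S) (m : S) : m ∈ below m := by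
  simp [mem_below, hS.idem]

/-- Inner factors commute, so `u ↦ x * u * x` is multiplicative. This is the compatibility required
by `forall_face_iff`. -/
theorem mem_below_mul (hS : IsNormalBand S) {x a b : S} :
    x ∈ below (a * b) ↔ x ∈ below a ∧ x ∈ below b := by
  simp only [mem_below]
  have h1 : ∀ u v, x * u * (x * v * x) = x * (u * v) * x := fun u v =>
    calc x * u * (x * v * x) = x * u * x * (v * x) := by simp only [mul_assoc]
      _ = x * x * u * (v * x) := hS.mul_mul_mul_comm' _ _ _ _
      _ = x * (u * v) * x := by rw [hS.idem]; simp only [mul_assoc]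
  constructor
  · intro h
    refine ⟨?_, ?_⟩
    · calc x * a * x = x * a * (x * (a * b) * x) := by rw [h]
        _ = x * (a * a * b) * x := by rw [h1]; simp only [mul_assoc]
        _ = x := by rw [hS.idem, h]
    · calc x * b * x = x * b * (x * (a * b) * x) := by rw [h]
        _ = x * b * a * b * x := by rw [h1]; simp only [mul_assoc]
        _ = x * a * b * b * x := by rw [hS.mul_mul_mul_comm' x b a b]
        _ = x * (a * (b * b)) * x := by simp only [mul_assoc]
        _ = x := by rw [hS.idem, h]
  · rintro ⟨ha, hb⟩
    rw [← h1, hb, ha]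

/-- Equality of the `below` sets gives `m = m * m' * m`, so in inner position `m` may be replaced by
`m * m'`, and by symmetry `m'` by `m' * m`; inner factors commute. -/
theorem sandwich_congr (hS : IsNormalBand S) {m m' : S} (h : below m = below m') (x y : S) :
    x * m * y = x * m' * y := by
  have key : ∀ {m m' : S}, below m = below m' → ∀ x y, x * m * y = x * (m * m') * y := by
    intro m m' h x y
    have hm : m * m' * m = m := by
      rw [← mem_below, ← h]; exact self_mem_below hS m
    calc x * m * y = x * (m * m' * m) * y := by rw [hm]
      _ = x * m * m' * m * y := by simp only [mul_assoc]
      _ = x * m * m * m' * y := by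
        rw [hS.mul_mul_mul_comm' (x * m) m' m y]
      _ = x * (m * m * m') * y := by simp only [mul_assoc]
      _ = x * (m * m') * y := by rw [hS.idem]
  rw [key h, key h.symm, ← mul_assoc, ← mul_assoc, hS.mul_mul_mul_comm']

theorem sandwich_mul (hS : IsNormalBand S) (m s t : S) :
    s * t * m * (s * t) = s * m * s * (t * m * t) := by
  calc s * t * m * (s * t) = s * t * (m * m) * (s * t) := by rw [hS.idem]
    _ = s * t * m * (m * s) * t := by simp only [mul_assoc]
    _ = s * (t * m) * (m * s) * t := by simp only [mul_assoc]
    _ = s * (m * s) * (t * m) * t := hS.mul_mul_mul_comm' _ _ _ _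
    _ = s * m * s * (t * m * t) := by simp only [mul_assoc]

/-- The endomorphism `s ↦ s m s` of a normal band. -/
def sandwich (hS : IsNormalBand S) (m : S) : S →ₙ* S where
  toFun s := s * m * s
  map_mul' := sandwich_mul hS m

/-- The product of the base point `s` and the entries of `x` listed in `l`. -/
def word {ι : Type*} (x : ι → S) (s : S) (l : List ι) : S := l.foldl (fun t k => t * x k) s

theorem map_word {T ι : Type*} [Semigroup T] (f : S →ₙ* T) (x : ι → S) (s : S) (l : List ι) :
    f (word x s l) = word (f ∘ x) (f s) l := by
  induction l generalizing s with
  | nil => rfl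
  | cons k l ih => simpa [word] using ih (s * x k)

theorem mul_word {ι : Type*} (x : ι → S) (t s : S) (l : List ι) :
    t * word x s l = word x (t * s) l := by
  induction l generalizing s with
  | nil => rfl
  | cons k l ih => simpa [word, mul_assoc] using ih (s * x k)

theorem mem_below_word (hS : IsNormalBand S) {ι : Type*} (x : ι → S) (s : S) (l : List ι) {y : S} :
    y ∈ below (word x s l) ↔ y ∈ below s ∧ ∀ k ∈ l, y ∈ below (x k) := by
  induction l generalizing s with
  | nil => simp [word]
  | cons k l ih =>
    have := ih (s * x k)
    rw [mem_below_mul hS] at this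
    simpa [word, and_assoc] using this

/-! ### Retraction of a tuple onto one rectangular component -/

open Hochschild

/-- The product of all the entries of a tuple. -/
def total {n : ℕ} (a : Fin (n + 1) → S) : S := word a (a 0) (List.finRange (n + 1))

theorem mem_below_total (hS : IsNormalBand S) {n : ℕ} (a : Fin (n + 1) → S) {y : S} :
    y ∈ below (total a) ↔ ∀ k, y ∈ below (a k) := by
  simp only [total, mem_below_word hS, List.mem_finRange, true_imp_iff]
  exact ⟨fun h => h.2, fun h => ⟨h 0, h⟩⟩

theorem map_total {T : Type*} [Semigroup T] (f : S →ₙ* T) {n : ℕ} (a : Fin (n + 1) → S) :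
    f (total a) = total (f ∘ a) :=
  map_word f a (a 0) _

theorem below_total_face (hS : IsNormalBand S) {n : ℕ} (i : Fin (n + 2)) (a : Fin (n + 2) → S) :
    below (total (face i a)) = below (total a) := by
  ext y
  rw [mem_below_total hS, mem_below_total hS]
  exact forall_face_iff (p := fun x => y ∈ below x) (fun _ _ => mem_below_mul hS) i a

/-- Moving all the entries of a tuple to the rectangular component of their product. -/
def retract {n : ℕ} (a : Fin (n + 1) → S) : Fin (n + 1) → S := fun k => a k * total a * a k

theorem retract_eq (hS : IsNormalBand S) {n : ℕ} (a : Fin (n + 1) → S) {m : S}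
    (hm : below m = below (total a)) : retract a = sandwich hS m ∘ a :=
  funext fun _ => (sandwich_congr hS hm _ _).symm

/-- A tuple and its face have total products in the same component, so one and the same endomorphism
retracts both, and homomorphisms commute with faces. -/
theorem retract_face (hS : IsNormalBand S) {n : ℕ} (i : Fin (n + 2)) (a : Fin (n + 2) → S) :
    retract (face i a) = face i (retract a) := by
  rw [retract_eq hS (face i a) (below_total_face hS i a).symm, retract_eq hS a rfl, comp_face]

theorem retract_zero (hS : IsNormalBand S) (a : Fin 1 → S) : retract a = a := by
  funext k
  have : below (total a) = below (a k) := by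
    ext y
    rw [mem_below_total hS, Fin.fin_one_eq_zero k]
    exact Fin.forall_fin_one
  rw [retract, sandwich_congr hS this, hS.idem, hS.idem]

theorem map_retract {T : Type*} [Semigroup T] (f : S →ₙ* T) {n : ℕ} (a : Fin (n + 1) → S) :
    f ∘ retract a = retract (f ∘ a) := by
  funext k
  simp [retract, ← map_total]

/-- A representative of the rectangular component of `m`. -/
noncomputable def rep (m : S) : S := (Quotient.mk (Setoid.ker below) m).out

theorem below_rep (m : S) : below (rep m) = below m :=
  Quotient.exact (Quotient.out_eq (Quotient.mk (Setoid.ker below) m))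

/-- This makes `rectHomotopy` use the same splitting element for a tuple and for all its faces; the
total products themselves may differ. -/
theorem rep_congr {m m' : S} (h : below m = below m') : rep m = rep m' := by
  unfold rep
  congr 1
  exact Quotient.sound h

/-! ### The contraction of the tuples with entries in a single rectangular component -/

/-- The splitting of the multiplication of a rectangular band given by an element `e`. -/
noncomputable def rectSplit (e x : S) : (S × S) →₀ ℂ := Finsupp.single (x * e, e * x) 1

/-- The contraction of the retracted tuples. -/
noncomputable def rectHomotopy {n : ℕ} (a : Fin (n + 1) → S) : AlgChain S (n + 1) :=
  split (rectSplit (rep (total a))) (retract a)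

/-- The retracted entries and `e = rep (total a)` lie in one rectangular component, where an inner
factor can be dropped: `x e e x = x`, `x y e = x e` and `e y x = e x`. These are the three
hypotheses of `algD_split`. -/
theorem algD_rectHomotopy (hS : IsNormalBand S) {n : ℕ} (a : Fin (n + 2) → S) :
    algD S (n + 1) (rectHomotopy a) = Finsupp.single (retract a) 1 -
      linExt rectHomotopy (algD S n (Finsupp.single a 1)) := by
  have hr : ∀ k, below (retract a k) = below (rep (total a)) := by
    intro k
    ext y
    rw [below_rep, retract, mem_below_mul hS, mem_below_mul hS, mem_below_total hS]
    exact ⟨fun h => h.1.2, fun h => ⟨⟨h k, h⟩, h k⟩⟩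
  have hf : ∀ i, rectHomotopy (face i a) =
      split (rectSplit (rep (total a))) (face i (retract a)) := by
    intro i
    rw [rectHomotopy, retract_face hS, rep_congr (below_total_face hS i a)]
  have e := algD_split (rectSplit (rep (total a))) (retract a) ?_ ?_ ?_
  · rw [rectHomotopy, e]
    simp [algD_single, hf]
  · simp only [rectSplit, Finsupp.mapDomain_single]
    congr 1
    calc retract a 0 * rep (total a) * (rep (total a) * retract a 0)
        = retract a 0 * (rep (total a) * rep (total a)) * retract a 0 := by simp only [mul_assoc]
      _ = retract a 0 := by rw [hS.idem, sandwich_congr hS (hr 0).symm, hS.idem, hS.idem]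
  · simp only [rectSplit, Finsupp.mapDomain_single]
    rw [sandwich_congr hS (hr 1), mul_assoc (retract a 0), hS.idem, mul_assoc]
  · simp only [rectSplit, Finsupp.mapDomain_single]
    rw [← mul_assoc (rep (total a)), sandwich_congr hS (hr (Fin.last _)), hS.idem, mul_assoc]

end NormalBand

/-! ### Free normal bands -/

/-- The free normal band on `ι`: an element is determined by its first letter, its last letter
and the set of its letters. -/
@[ext]
structure FreeNormalBand (ι : Type*) where
  fst : ι
  supp : Finset ι
  snd : ι
  fst_mem : fst ∈ supp
  snd_mem : snd ∈ supp

namespace FreeNormalBand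

variable {ι : Type*} [DecidableEq ι]

instance : Semigroup (FreeNormalBand ι) where
  mul p q := ⟨p.fst, p.supp ∪ q.supp, q.snd, Finset.mem_union_left _ p.fst_mem,
    Finset.mem_union_right _ q.snd_mem⟩
  mul_assoc _ _ _ := FreeNormalBand.ext rfl (Finset.union_assoc _ _ _) rfl

theorem mul_fst (p q : FreeNormalBand ι) : (p * q).fst = p.fst := rfl
theorem mul_snd (p q : FreeNormalBand ι) : (p * q).snd = q.snd := rfl
theorem mul_supp (p q : FreeNormalBand ι) : (p * q).supp = p.supp ∪ q.supp := rfl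

theorem isNormalBand : IsNormalBand (FreeNormalBand ι) where
  idem p := FreeNormalBand.ext rfl (Finset.union_self _) rfl
  normal a b c := by
    refine FreeNormalBand.ext rfl ?_ rfl
    simp only [mul_supp]
    rw [Finset.union_right_comm a.supp]

/-- The generators of the free normal band. -/
def of (k : ι) : FreeNormalBand ι := ⟨k, {k}, k, by simp, by simp⟩

open NormalBand

variable {S : Type*} [Semigroup S]

/-- The homomorphism from the free normal band extending a map on the generators. -/
noncomputable def eval (hS : IsNormalBand S) (x : ι → S) : FreeNormalBand ι →ₙ* S where
  toFun p := word x (x p.fst) p.supp.toList * x p.snd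
  map_mul' p q := by
    -- Repeating the first letter puts the word between two factors. By `sandwich_congr` only its
    -- set of letters then matters, not the order chosen by `toList`.
    have habs : ∀ (r : FreeNormalBand ι),
        word x (x r.fst) r.supp.toList = x r.fst * word x (x r.fst) r.supp.toList := by
      intro r
      rw [mul_word, hS.idem]
    have key : below (word x (x p.fst) (p.supp ∪ q.supp).toList) =
        below (word x (x p.fst) p.supp.toList * x p.snd * word x (x q.fst) q.supp.toList) := by
      ext y
      have h1 := p.fst_mem
      have h2 := p.snd_mem
      have h3 := q.fst_mem
      simp only [mem_below_mul hS, mem_below_word hS, Finset.mem_toList, Finset.mem_union]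
      grind
    calc word x (x p.fst) (p * q).supp.toList * x q.snd
        = x p.fst * word x (x p.fst) (p.supp ∪ q.supp).toList * x q.snd :=
          congrArg (· * x q.snd) (habs (p * q))
      _ = _ := by
        rw [sandwich_congr hS key, habs p]
        simp only [← mul_assoc, hS.idem]

theorem eval_of (hS : IsNormalBand S) (x : ι → S) (k : ι) : eval hS x (of k) = x k := by
  simp [eval, of, word, hS.idem]

theorem map_eval {T : Type*} [Semigroup T] (hS : IsNormalBand S) (hT : IsNormalBand T)
    (f : S →ₙ* T) (x : ι → S) : f ∘ eval hS x = eval hT (f ∘ x) := by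
  funext p
  simp [eval, map_word]

/-! ### Möbius inversion and the section of the multiplication -/

variable [Fintype ι]

/-- The element with given first and last letter, and with the given letters in between. -/
def el (i : ι) (M : Finset ι) (j : ι) : FreeNormalBand ι :=
  ⟨i, insert i (insert j M), j, by simp, by simp⟩

-- Inserting or erasing `b` pairs off the terms with opposite signs.
omit [Fintype ι] in
theorem sum_neg_one_pow_card_smul_eq_zero {V : Type*} [AddCommGroup V] [Module ℂ V] (b : ι)
    (s : Finset (Finset ι)) (h1 : ∀ M ∈ s, insert b M ∈ s) (h2 : ∀ M ∈ s, M.erase b ∈ s)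
    (G : Finset ι → V) (hG : ∀ M ∈ s, G (insert b M) = G M) :
    ∑ M ∈ s, (-1 : ℂ) ^ M.card • G M = 0 := by
  refine Finset.sum_involution (fun M _ => if b ∈ M then M.erase b else insert b M) ?_ ?_ ?_ ?_
  · intro M hM
    split_ifs with h
    · have e := hG _ (h2 M hM)
      rw [Finset.insert_erase h] at e
      have : M.card = (M.erase b).card + 1 := (Finset.card_erase_add_one h).symm
      rw [e, this, pow_succ]
      simp
    · rw [hG M hM, Finset.card_insert_of_notMem h, pow_succ]
      simp
  · intro M hM _
    split_ifs with h
    · exact fun e => (Finset.erase_ne_self.2 h) e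
    · exact fun e => (Finset.insert_ne_self.2 h) e
  · intro M hM
    split_ifs with h
    · exact h2 M hM
    · exact h1 M hM
  · intro M hM
    by_cases h : b ∈ M
    · simp [h]
    · simp [h]

/-- A chosen element of a nonempty finite set. -/
noncomputable def pt [Nonempty ι] (J : Finset ι) : ι := Classical.epsilon (· ∈ J)

omit [DecidableEq ι] [Fintype ι] in
theorem pt_mem [Nonempty ι] {J : Finset ι} {i : ι} (h : i ∈ J) : pt J ∈ J :=
  Classical.epsilon_spec (p := (· ∈ J)) ⟨i, h⟩

/-- The bimodule section of the multiplication of `ℂ[FreeNormalBand ι]`. -/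
noncomputable def mulSection [Nonempty ι] (p : FreeNormalBand ι) :
    (FreeNormalBand ι × FreeNormalBand ι) →₀ ℂ :=
  -- By Möbius inversion `p` is the sum over `J ⊇ p.supp` of the elements `∑_{M ⊇ J} (-1)^(|M| -
  -- |J|) el p.fst M p.snd`. Those belonging to `J` multiply like a rectangular band on `J × J`, and
  -- each is split as `x ↦ x e ⊗ e x` with `e = (pt J, pt J)`. The two signs `(-1)^|J|` cancel.
  ∑ J with p.supp ⊆ J, ∑ M with J ⊆ M, (-1 : ℂ) ^ M.card • ∑ N with J ⊆ N, (-1 : ℂ) ^ N.card •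
    Finsupp.single (el p.fst M (pt J), el (pt J) N p.snd) 1

variable [Nonempty ι]

theorem mapDomain_mulSection {Y : Type*} (f : FreeNormalBand ι × FreeNormalBand ι → Y)
    (p : FreeNormalBand ι) : (mulSection p).mapDomain f =
      ∑ J with p.supp ⊆ J, ∑ M with J ⊆ M, (-1 : ℂ) ^ M.card • ∑ N with J ⊆ N, (-1 : ℂ) ^ N.card •
        Finsupp.single (f (el p.fst M (pt J), el (pt J) N p.snd)) 1 := by
  simp [mulSection, Finsupp.mapDomain_finsetSum, Finsupp.mapDomain_smul]

theorem mulSection_mul_right (p b : FreeNormalBand ι) :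
    (mulSection p).mapDomain (fun q => (q.1, q.2 * b)) = mulSection (p * b) := by
  rw [mapDomain_mulSection, mulSection]
  symm
  have hsub : ({J | (p * b).supp ⊆ J} : Finset (Finset ι)) ⊆ ({J | p.supp ⊆ J} : Finset _) := by
    intro J
    simp only [Finset.mem_filter_univ, mul_supp]
    exact fun h => Finset.subset_union_left.trans h
  refine Finset.sum_subset_zero_on_sdiff hsub ?_ ?_
  · intro J hJ
    simp only [Finset.mem_sdiff, Finset.mem_filter_univ, mul_supp, Finset.union_subset_iff,
      not_and] at hJ
    -- Here `c` is a letter of `b` outside `J`: the product with `b` does not see whether `c ∈ N`,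
    -- so the sum over `N` vanishes.
    obtain ⟨c, hc, hcJ⟩ := Finset.not_subset.1 (hJ.2 hJ.1)
    refine Finset.sum_eq_zero fun M _ => ?_
    rw [sum_neg_one_pow_card_smul_eq_zero c, smul_zero]
    · intro N hN
      simp only [Finset.mem_filter_univ] at hN ⊢
      exact hN.trans (Finset.subset_insert _ _)
    · intro N hN
      simp only [Finset.mem_filter_univ] at hN ⊢
      exact Finset.subset_erase.2 ⟨hN, hcJ⟩
    · intro N hN
      congr 2
      refine FreeNormalBand.ext rfl ?_ rfl
      simp only [mul_supp, el]
      grind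
  · intro J hJ
    simp only [Finset.mem_filter_univ, mul_supp, Finset.union_subset_iff] at hJ
    have hp := pt_mem (hJ.1 p.fst_mem)
    refine Finset.sum_congr rfl fun M _ => ?_
    congr 1
    refine Finset.sum_congr rfl fun N hN => ?_
    simp only [Finset.mem_filter_univ] at hN
    congr 3
    refine FreeNormalBand.ext rfl ?_ rfl
    have h1 := hJ.1 p.snd_mem
    have h2 := b.snd_mem
    simp only [mul_supp, mul_snd, el]
    grind

theorem mulSection_mul_left (p b : FreeNormalBand ι) :
    (mulSection p).mapDomain (fun q => (b * q.1, q.2)) = mulSection (b * p) := by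
  rw [mapDomain_mulSection, mulSection]
  symm
  have hsub : ({J | (b * p).supp ⊆ J} : Finset (Finset ι)) ⊆ ({J | p.supp ⊆ J} : Finset _) := by
    intro J
    simp only [Finset.mem_filter_univ, mul_supp]
    exact fun h => Finset.subset_union_right.trans h
  refine Finset.sum_subset_zero_on_sdiff hsub ?_ ?_
  · intro J hJ
    simp only [Finset.mem_sdiff, Finset.mem_filter_univ, mul_supp, Finset.union_subset_iff,
      and_comm, not_and] at hJ
    obtain ⟨c, hc, hcJ⟩ := Finset.not_subset.1 (hJ.2 hJ.1)
    rw [sum_neg_one_pow_card_smul_eq_zero c]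
    · intro N hN
      simp only [Finset.mem_filter_univ] at hN ⊢
      exact hN.trans (Finset.subset_insert _ _)
    · intro N hN
      simp only [Finset.mem_filter_univ] at hN ⊢
      exact Finset.subset_erase.2 ⟨hN, hcJ⟩
    · intro M hM
      refine Finset.sum_congr rfl fun N _ => ?_
      congr 3
      refine FreeNormalBand.ext rfl ?_ rfl
      simp only [mul_supp, el]
      grind
  · intro J hJ
    simp only [Finset.mem_filter_univ, mul_supp, Finset.union_subset_iff] at hJ
    have hp := pt_mem (hJ.2 p.fst_mem)
    refine Finset.sum_congr rfl fun M hM => ?_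
    congr 1
    refine Finset.sum_congr rfl fun N _ => ?_
    simp only [Finset.mem_filter_univ] at hM
    congr 3
    refine FreeNormalBand.ext rfl ?_ rfl
    have h1 := hJ.2 p.fst_mem
    have h2 := b.fst_mem
    simp only [mul_supp, mul_fst, el]
    grind

theorem mulSection_mul (p : FreeNormalBand ι) :
    (mulSection p).mapDomain (fun q => q.1 * q.2) = Finsupp.single p 1 := by
  -- The product depends on `M ∪ N` only; if `M ≠ J`, a letter of `M` outside `J` can be toggled in
  -- `N`, so only `M = J` survives.
  have inner : ∀ J, p.supp ⊆ J → ∑ M with J ⊆ M, (-1 : ℂ) ^ M.card • ∑ N with J ⊆ N,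
      (-1 : ℂ) ^ N.card • Finsupp.single (el p.fst M (pt J) * el (pt J) N p.snd) (1 : ℂ) =
      (-1 : ℂ) ^ J.card • ∑ N with J ⊆ N, (-1 : ℂ) ^ N.card •
        Finsupp.single (el p.fst N p.snd) (1 : ℂ) := by
    intro J hJ
    have hp := pt_mem (hJ p.fst_mem)
    have h1 := hJ p.fst_mem
    have h2 := hJ p.snd_mem
    rw [Finset.sum_eq_single J]
    · congr 1
      refine Finset.sum_congr rfl fun N hN => ?_
      simp only [Finset.mem_filter_univ] at hN
      congr 2
      refine FreeNormalBand.ext rfl ?_ rfl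
      simp only [mul_supp, el]
      grind
    · intro M hM hMJ
      simp only [Finset.mem_filter_univ] at hM
      obtain ⟨c, hc, hcJ⟩ := Finset.not_subset.1 fun h => hMJ (Finset.Subset.antisymm h hM)
      rw [sum_neg_one_pow_card_smul_eq_zero c, smul_zero]
      · intro N hN
        simp only [Finset.mem_filter_univ] at hN ⊢
        exact hN.trans (Finset.subset_insert _ _)
      · intro N hN
        simp only [Finset.mem_filter_univ] at hN ⊢
        exact Finset.subset_erase.2 ⟨hN, hcJ⟩
      · intro N hN
        congr 1
        refine FreeNormalBand.ext rfl ?_ rfl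
        simp only [mul_supp, el]
        grind
    · simp
  rw [mapDomain_mulSection, Finset.sum_congr rfl fun J hJ => inner J (by simpa using hJ)]
  simp only [Finset.smul_sum]
  -- For fixed `N` the alternating sum over `p.supp ⊆ J ⊆ N` vanishes unless `N = p.supp`.
  rw [Finset.sum_comm' (t' := {N | p.supp ⊆ N})
    (s' := fun N => ({J | p.supp ⊆ J ∧ J ⊆ N} : Finset (Finset ι)))]
  · rw [Finset.sum_eq_single p.supp]
    · have : ({J | p.supp ⊆ J ∧ J ⊆ p.supp} : Finset (Finset ι)) = {p.supp} := by
        ext J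
        simp only [Finset.mem_filter_univ, Finset.mem_singleton]
        exact ⟨fun h => Finset.Subset.antisymm h.2 h.1, by rintro rfl; simp⟩
      rw [this, Finset.sum_singleton, smul_smul, ← mul_pow]
      have h3 : el p.fst p.supp p.snd = p := by
        refine FreeNormalBand.ext rfl ?_ rfl
        have := p.fst_mem
        have := p.snd_mem
        simp only [el]
        grind
      simp [h3]
    · intro N hN hne
      simp only [Finset.mem_filter_univ] at hN
      obtain ⟨c, hc, hcJ⟩ := Finset.not_subset.1 fun h => hne (Finset.Subset.antisymm h hN)
      refine sum_neg_one_pow_card_smul_eq_zero c _ ?_ ?_ _ fun _ _ => rfl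
      · intro J hJ
        simp only [Finset.mem_filter_univ] at hJ ⊢
        grind
      · intro J hJ
        simp only [Finset.mem_filter_univ] at hJ ⊢
        grind
    · simp
  · intro J N
    simp only [Finset.mem_filter_univ]
    exact ⟨fun h => ⟨h, h.1.trans h.2⟩, fun h => h.1⟩

end FreeNormalBand

/-! ### The natural homotopy and the contraction -/

namespace NormalBand

open Hochschild FreeNormalBand

/-- The tuple of the generators of the free normal band. -/
def generic (n : ℕ) : Fin (n + 1) → FreeNormalBand (Fin (n + 1)) := of

/-- The universal chains defining a natural homotopy from the identity to the retraction. -/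
noncomputable def universalChain : (n : ℕ) → AlgChain (FreeNormalBand (Fin (n + 1))) (n + 1)
  -- The retraction is the identity on 1-tuples (`retract_zero`).
  | 0 => 0
  -- The contraction of the free band is applied to what the homotopy has to bound, which proves to
  -- be a cycle.
  | n + 1 => linExt (split mulSection)
      (Finsupp.single (generic (n + 1)) 1 - Finsupp.single (retract (generic (n + 1))) 1 -
        linExt (fun b => push (eval isNormalBand b) (n + 1) (universalChain n))
          (algD _ n (Finsupp.single (generic (n + 1)) 1)))

/-- The natural homotopy from the identity to the retraction. -/
noncomputable def retractHomotopy {S : Type*} [Semigroup S] (hS : IsNormalBand S) {n : ℕ}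
    (a : Fin (n + 1) → S) : AlgChain S (n + 1) :=
  push (eval hS a) (n + 1) (universalChain n)

theorem push_retractHomotopy {S T : Type*} [Semigroup S] [Semigroup T] (hS : IsNormalBand S)
    (hT : IsNormalBand T) (f : S →ₙ* T) {n : ℕ} (a : Fin (n + 1) → S) :
    push f (n + 1) (retractHomotopy hS a) = retractHomotopy hT (f ∘ a) := by
  rw [retractHomotopy, push_push, map_eval hS hT, retractHomotopy]

/-- The defect of `retractHomotopy` in the previous degree. -/
noncomputable def retractDefect {S : Type*} [Semigroup S] (hS : IsNormalBand S) {n : ℕ}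
    (a : Fin (n + 2) → S) : AlgChain S (n + 1) :=
  Finsupp.single a 1 - Finsupp.single (retract a) 1 -
    linExt (retractHomotopy hS) (algD S n (Finsupp.single a 1))

theorem push_retractDefect {S T : Type*} [Semigroup S] [Semigroup T] (hS : IsNormalBand S)
    (hT : IsNormalBand T) (f : S →ₙ* T) {n : ℕ} (a : Fin (n + 2) → S) :
    push f (n + 1) (retractDefect hS a) = retractDefect hT (f ∘ a) := by
  simp only [retractDefect, map_sub, push_single, map_retract, algD_single, map_sum, map_smul,
    Finsupp.linearCombination_single, one_smul, push_retractHomotopy hS hT, comp_face]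

theorem universalChain_succ (n : ℕ) : universalChain (n + 1) =
    linExt (split mulSection) (retractDefect isNormalBand (generic (n + 1))) := rfl

theorem algD_linExt_split {ι : Type*} [DecidableEq ι] [Fintype ι] [Nonempty ι] {n : ℕ}
    (y : AlgChain (FreeNormalBand ι) (n + 1)) :
    algD _ (n + 1) (linExt (split mulSection) y) = y - linExt (split mulSection) (algD _ n y) := by
  induction y using Finsupp.induction_linear with
  | zero => simp
  | add y z hy hz => simp only [map_add, hy, hz]; abel
  | single b c =>
    have : Finsupp.single b c = c • Finsupp.single b (1 : ℂ) := by simp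
    rw [this, map_smul, map_smul, Finsupp.linearCombination_single, one_smul,
      algD_split mulSection b (mulSection_mul _) (mulSection_mul_right _ _)
        (mulSection_mul_left _ _), map_smul, map_smul, smul_sub]

theorem algD_single_retract {S : Type*} [Semigroup S] (hS : IsNormalBand S) {n : ℕ}
    (a : Fin (n + 2) → S) : algD S n (Finsupp.single (retract a) 1) =
      linExt (fun b => Finsupp.single (retract b) 1) (algD S n (Finsupp.single a 1)) := by
  simp [algD_single, retract_face hS]

theorem linExt_sub {ι V : Type*} [AddCommGroup V] [Module ℂ V] (f g : ι → V) (z : ι →₀ ℂ) :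
    linExt (fun i => f i - g i) z = linExt f z - linExt g z := by
  simp [Finsupp.linearCombination_apply, smul_sub, Finsupp.sum_sub]

theorem map_linExt {ι V W : Type*} [AddCommGroup V] [Module ℂ V] [AddCommGroup W] [Module ℂ W]
    (L : V →ₗ[ℂ] W) (f : ι → V) (z : ι →₀ ℂ) : L (linExt f z) = linExt (fun i => L (f i)) z :=
  Finsupp.apply_linearCombination ℂ L f z

theorem linExt_single_one {ι : Type*} (z : ι →₀ ℂ) :
    linExt (fun i => Finsupp.single i (1 : ℂ)) z = z := by
  simp [Finsupp.linearCombination_apply]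

theorem linExt_linExt {ι κ V : Type*} [AddCommGroup V] [Module ℂ V] (f : κ → V)
    (g : ι → κ →₀ ℂ) (z : ι →₀ ℂ) :
    linExt (fun i => linExt f (g i)) z = linExt f (linExt g z) :=
  (map_linExt _ _ _).symm

theorem linExt_algD_single {S : Type*} [Mul S] {n : ℕ} (z : AlgChain S (n + 1)) :
    linExt (fun a => algD S n (Finsupp.single a 1)) z = algD S n z := by
  rw [← map_linExt, linExt_single_one]

theorem retractHomotopy_zero {S : Type*} [Semigroup S] (hS : IsNormalBand S)
    (a : Fin 1 → S) : retractHomotopy hS (n := 0) a = 0 := by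
  simp [retractHomotopy, universalChain]

theorem algD_retractDefect_zero {S : Type*} [Semigroup S] (hS : IsNormalBand S) (a : Fin 2 → S) :
    algD S 0 (retractDefect hS (n := 0) a) = 0 := by
  rw [retractDefect, map_sub, map_sub, algD_single_retract hS]
  simp only [retract_zero hS, linExt_single_one, sub_self, zero_sub, neg_eq_zero]
  simp [retractHomotopy_zero, algD_single]

/-- Writing `h` for the homotopy and `r` for the retraction, `d (1 - r - h d) = d - r d - (1 - r - h
d) d = h d d = 0`. -/
theorem algD_retractDefect_succ {S : Type*} [Semigroup S] (hS : IsNormalBand S) {n : ℕ}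
    (h : ∀ b : Fin (n + 2) → S, algD S (n + 1) (retractHomotopy hS b) = retractDefect hS b)
    (a : Fin (n + 3) → S) : algD S (n + 1) (retractDefect hS a) = 0 := by
  rw [retractDefect, map_sub, map_sub, algD_single_retract hS, map_linExt]
  simp only [h, retractDefect, linExt_sub, linExt_single_one, linExt_linExt, linExt_algD_single,
    algD_algD, map_zero, sub_zero, sub_self]

/-- On the generic tuple the defect is a cycle, so the contraction bounds it; naturality along `eval
hS a` carries this to the tuple `a`. -/
theorem algD_retractHomotopy_of_generic {n : ℕ}
    (h : algD _ n (retractDefect isNormalBand (generic (n + 1))) = 0) {S : Type*} [Semigroup S]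
    (hS : IsNormalBand S) (a : Fin (n + 2) → S) :
    algD S (n + 1) (retractHomotopy hS a) = retractDefect hS a := by
  have e : eval hS a ∘ generic (n + 1) = a := funext fun k => eval_of hS a k
  rw [retractHomotopy, algD_push, universalChain_succ, algD_linExt_split, h, map_zero, sub_zero,
    push_retractDefect isNormalBand hS, e]

theorem algD_retractDefect_generic (n : ℕ) :
    algD _ n (retractDefect isNormalBand (generic (n + 1))) = 0 := by
  induction n with
  | zero => exact algD_retractDefect_zero _ _
  -- The induction passes through all normal bands: the faces of the next generic tuple are not
  -- generic.
  | succ n ih => exact algD_retractDefect_succ _ (algD_retractHomotopy_of_generic ih _) _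

/-- A contraction of the chain complex of a normal band in positive degrees. -/
noncomputable def contraction {S : Type*} [Semigroup S] (hS : IsNormalBand S) {n : ℕ}
    (a : Fin (n + 1) → S) : AlgChain S (n + 1) :=
  retractHomotopy hS a + rectHomotopy a

/-- The two homotopies satisfy `d h + h d = 1 - r` and `d k + k d = r`, and are added. -/
theorem algD_contraction {S : Type*} [Semigroup S] (hS : IsNormalBand S) {n : ℕ}
    (a : Fin (n + 2) → S) :
    algD S (n + 1) (contraction hS a) + ∑ i : Fin (n + 2), (-1 : ℂ) ^ (i : ℕ) •
      contraction hS (face i a) = Finsupp.single a 1 := by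
  rw [contraction, map_add, algD_retractHomotopy_of_generic (algD_retractDefect_generic n),
    algD_rectHomotopy hS, retractDefect]
  simp only [algD_single, map_sum, map_smul, Finsupp.linearCombination_single, one_smul,
    contraction, smul_add, Finset.sum_add_distrib]
  abel

end NormalBand

/-! ### Multilinear maps on `ℓ¹` -/

namespace Ell1

variable {S : Type u} {E : Type*} [NormedAddCommGroup E] [NormedSpace ℂ E]

open Classical in
/-- The point mass at `s`. -/
noncomputable def point (s : S) : Ell1 S := lp.single 1 s 1

theorem norm_point (s : S) : ‖point s‖ = 1 := by
  simp [point, lp.norm_single]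

theorem point_mul_point [Mul S] (s t : S) : point s * point t = point (s * t) := by
  simp [point, single_mul_single]

theorem clm_ext_point {L M : Ell1 S →L[ℂ] E} (h : ∀ s, L (point s) = M (point s)) : L = M := by
  classical
  ext f
  refine clm_ext (fun s a => ?_) f
  have : (lp.single 1 s a : Ell1 S) = a • point s := by
    rw [point, ← lp.single_smul]
    simp
  rw [this, map_smul, map_smul, h]

theorem exists_clm_extending [CompleteSpace E] (g : S → E) {C : ℝ} (hC : 0 ≤ C)
    (hg : ∀ s, ‖g s‖ ≤ C) :
    ∃ L : Ell1 S →L[ℂ] E, (∀ s, L (point s) = g s) ∧ ‖L‖ ≤ C := by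
  have hb : ∀ (f : Ell1 S) s, ‖f s • g s‖ ≤ ‖f s‖ * C := fun f s => by
    rw [norm_smul]
    exact mul_le_mul_of_nonneg_left (hg s) (norm_nonneg _)
  have hn : ∀ f : Ell1 S, Summable fun s => ‖f s • g s‖ := fun f =>
    Summable.of_nonneg_of_le (fun _ => norm_nonneg _) (hb f) ((summable_norm f).mul_right C)
  have hs : ∀ f : Ell1 S, Summable fun s => f s • g s := fun f => (hn f).of_norm
  let L₀ : Ell1 S →ₗ[ℂ] E :=
    { toFun := fun f => ∑' s, f s • g s
      map_add' := fun f h => by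
        simp only [lp.coeFn_add, Pi.add_apply, add_smul]
        exact (hs f).tsum_add (hs h)
      map_smul' := fun c f => by
        simp only [lp.coeFn_smul, Pi.smul_apply, smul_assoc, RingHom.id_apply]
        exact (hs f).tsum_const_smul c }
  have hL : ∀ f, ‖L₀ f‖ ≤ C * ‖f‖ := fun f => by
    calc ‖∑' s, f s • g s‖ ≤ ∑' s, ‖f s • g s‖ := norm_tsum_le_tsum_norm (hn f)
      _ ≤ ∑' s, ‖f s‖ * C := (hn f).tsum_le_tsum (hb f) ((summable_norm f).mul_right C)
      _ = C * ‖f‖ := by rw [tsum_mul_right, norm_eq_tsum, mul_comm]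
  refine ⟨L₀.mkContinuous C hL, fun s => ?_, L₀.mkContinuous_norm_le hC hL⟩
  classical
  change ∑' t, (point s) t • g t = g s
  rw [tsum_eq_single s]
  · simp [point]
  · intro t ht
    simp [point, ht]

theorem multilinear_ext {n : ℕ} {Φ Ψ : ContinuousMultilinearMap ℂ (fun _ : Fin n => Ell1 S) E}
    (h : ∀ a : Fin n → S, Φ (fun k => point (a k)) = Ψ (fun k => point (a k))) : Φ = Ψ := by
  induction n with
  | zero =>
    ext x
    convert h Fin.elim0
  | succ n ih =>
    have : Φ.curryLeft = Ψ.curryLeft := by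
      refine clm_ext_point fun s => ih fun a => ?_
      have e : (Fin.cons (point s) fun k => point (a k) : Fin (n + 1) → Ell1 S) =
          fun k => point ((Fin.cons s a : Fin (n + 1) → S) k) := by
        funext k
        refine Fin.cases ?_ (fun k => ?_) k <;> simp
      simpa [e] using h (Fin.cons s a)
    rw [← Φ.uncurry_curryLeft, this, Ψ.uncurry_curryLeft]

/-- Induction by currying: the multilinear maps obtained by fixing the first point are a family on
`S` bounded by the same `C`, to which `exists_clm_extending` applies. -/
theorem exists_multilinear_extending [CompleteSpace E] {n : ℕ} (φ : (Fin n → S) → E) {C : ℝ}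
    (hC : 0 ≤ C) (hφ : ∀ a, ‖φ a‖ ≤ C) :
    ∃ Φ : ContinuousMultilinearMap ℂ (fun _ : Fin n => Ell1 S) E,
      (∀ a, Φ (fun k => point (a k)) = φ a) ∧ ‖Φ‖ ≤ C := by
  induction n with
  | zero =>
    refine ⟨ContinuousMultilinearMap.constOfIsEmpty ℂ _ (φ Fin.elim0), fun a => ?_, ?_⟩
    · simp [Subsingleton.elim a Fin.elim0]
    · simpa using hφ _
  | succ n ih =>
    choose Φ hΦ hΦC using fun s : S => ih (fun a => φ (Fin.cons s a)) fun a => hφ _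
    obtain ⟨L, hL, hLC⟩ := exists_clm_extending Φ hC hΦC
    refine ⟨L.uncurryLeft, fun a => ?_, by simpa using hLC⟩
    rw [ContinuousLinearMap.uncurryLeft_apply, hL]
    have := hΦ (a 0) (Fin.tail a)
    rw [Fin.cons_self_tail] at this
    exact this

end Ell1

/-! ### Chains on `ℓ¹(S)` -/

namespace Hochschild

open Ell1

section Complex

variable {A : Type u} [NonUnitalNormedRing A] [NormedSpace ℂ A] [IsScalarTower ℂ A A]
  [SMulCommClass ℂ A A] {E : Type*} [NormedAddCommGroup E] [NormedSpace ℂ E]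

/-- The elementary tensor `a₀ ⊗ ⋯ ⊗ aₙ`. -/
noncomputable def elementary {n : ℕ} (a : Fin (n + 1) → A) : Chain A n :=
  ((PiTensorProduct.tprod ℂ a : PiTensorProduct ℂ fun _ : Fin (n + 1) => A) : Chain A n)

omit [IsScalarTower ℂ A A] [SMulCommClass ℂ A A] in
theorem norm_elementary_le {n : ℕ} (a : Fin (n + 1) → A) : ‖elementary a‖ ≤ ∏ k, ‖a k‖ := by
  rw [elementary, UniformSpace.Completion.norm_coe]
  exact PiTensorProduct.projectiveSeminorm_tprod_le a

theorem faceMap_elementary {n : ℕ} (i : Fin (n + 2)) (a : Fin (n + 2) → A) :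
    faceMap A n i (elementary a) = elementary (face i a) := by
  rw [faceMap, elementary, ContinuousLinearMap.completion_apply_coe,
    PiTensorProduct.liftIsometry_apply_apply]
  simp [elementary, faceMultilinear]

theorem d_elementary {n : ℕ} (a : Fin (n + 2) → A) :
    d A n (elementary a) = ∑ i : Fin (n + 2), (-1 : ℂ) ^ (i : ℕ) • elementary (face i a) := by
  simp [d, faceMap_elementary]

/-- The bounded multilinear map underlying a bounded linear map on chains. -/
noncomputable def toMultilinear {n : ℕ} (L : Chain A n →L[ℂ] E) :
    ContinuousMultilinearMap ℂ (fun _ : Fin (n + 1) => A) E :=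
  (L.comp UniformSpace.Completion.toComplL).compContinuousMultilinearMap (PiTensorProduct.tprodL ℂ)

theorem toMultilinear_apply {n : ℕ} (L : Chain A n →L[ℂ] E) (a : Fin (n + 1) → A) :
    toMultilinear L a = L (elementary a) := by
  simp [toMultilinear, elementary]

theorem toMultilinear_injective {n : ℕ} :
    Function.Injective (toMultilinear : (Chain A n →L[ℂ] E) → _) := by
  intro L M h
  ext z
  refine UniformSpace.Completion.ext' L.continuous M.continuous (fun x => ?_) z
  have : (L.comp UniformSpace.Completion.toComplL).toLinearMap =
      (M.comp UniformSpace.Completion.toComplL).toLinearMap := by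
    refine PiTensorProduct.ext ?_
    ext a
    simpa [toMultilinear] using congrArg (fun Φ => Φ a) h
  exact congrArg (fun Φ => Φ x) this

theorem exists_clm_of_multilinear [CompleteSpace E] {n : ℕ}
    (Φ : ContinuousMultilinearMap ℂ (fun _ : Fin (n + 1) => A) E) :
    ∃ L : Chain A n →L[ℂ] E, ∀ a, L (elementary a) = Φ a := by
  refine ⟨(PiTensorProduct.liftIsometry ℂ (fun _ : Fin (n + 1) => A) E Φ).extend
    UniformSpace.Completion.toComplL, fun a => ?_⟩
  have := ContinuousLinearMap.extend_eq
    (PiTensorProduct.liftIsometry ℂ (fun _ : Fin (n + 1) => A) E Φ)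
    (e := UniformSpace.Completion.toComplL)
    (by rw [UniformSpace.Completion.coe_toComplL]; exact UniformSpace.Completion.denseRange_coe)
    (by
      rw [UniformSpace.Completion.coe_toComplL]
      exact UniformSpace.Completion.isUniformInducing_coe _)
    (PiTensorProduct.tprod ℂ a)
  rw [UniformSpace.Completion.coe_toComplL] at this
  rw [elementary, this, PiTensorProduct.liftIsometry_apply_apply]
  simp

omit [IsScalarTower ℂ A A] [SMulCommClass ℂ A A] in
/-- The coboundary of a cochain is dual to the boundary of chains. -/
theorem coboundary_eq_sum {n : ℕ} (T : Cochain A n) (a : Fin (n + 1) → A) (x : A) :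
    coboundary T a x = ∑ i : Fin (n + 2), (-1 : ℂ) ^ (i : ℕ) *
      T (Fin.tail (face i (Fin.cons x a : Fin (n + 2) → A)))
        (face i (Fin.cons x a : Fin (n + 2) → A) 0) := by
  have h0 : face 0 (Fin.cons x a : Fin (n + 2) → A) = Fin.cons (x * a 0) (Fin.tail a) := by
    funext k
    refine Fin.cases ?_ (fun k => ?_) k
    · simp [face_apply]
    · simp [face_apply, Fin.tail, -Fin.castSucc_succ]
  have hl : face (Fin.last (n + 1)) (Fin.cons x a : Fin (n + 2) → A) =
      Fin.cons (a (Fin.last n) * x) (Fin.init a) := by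
    funext k
    refine Fin.cases ?_ (fun k => ?_) k
    · simp [face_apply, ← Fin.succ_last]
    · simp [face_apply, Fin.init]
  have hj : ∀ j : Fin n, face j.castSucc.succ (Fin.cons x a : Fin (n + 2) → A) =
      Fin.cons x (j.castSucc.contractNth (· * ·) a) := by
    intro j
    funext k
    have := j.isLt
    refine Fin.cases ?_ (fun k => ?_) k
    · simp [face_apply, this.ne]
    · simp [face_apply, this.ne, Fin.contractNth]
  rw [Fin.sum_univ_succ, Fin.sum_univ_castSucc, coboundary, Fin.succ_last, h0, hl]
  simp only [hj]
  simp [add_assoc]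

end Complex

section Ell1

variable {S : Type u} [Semigroup S] {E : Type*} [NormedAddCommGroup E] [NormedSpace ℂ E]

/-- The elementary tensor of point masses. -/
noncomputable def chainPoint {n : ℕ} (a : Fin (n + 1) → S) : Chain (Ell1 S) n :=
  elementary fun k => point (a k)

theorem norm_chainPoint_le {n : ℕ} (a : Fin (n + 1) → S) : ‖chainPoint a‖ ≤ 1 := by
  simpa [norm_point, chainPoint] using norm_elementary_le fun k => point (a k)

theorem faceMap_chainPoint {n : ℕ} (i : Fin (n + 2)) (a : Fin (n + 2) → S) :
    faceMap (Ell1 S) n i (chainPoint a) = chainPoint (face i a) := by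
  rw [chainPoint, faceMap_elementary, chainPoint]
  congr 1
  funext k
  simp only [face_apply]
  split_ifs <;> simp [point_mul_point]

theorem d_chainPoint {n : ℕ} (a : Fin (n + 2) → S) : d (Ell1 S) n (chainPoint a) =
    ∑ i : Fin (n + 2), (-1 : ℂ) ^ (i : ℕ) • chainPoint (face i a) := by
  simp [d, faceMap_chainPoint]

theorem clm_ext_chainPoint {n : ℕ} {L M : Chain (Ell1 S) n →L[ℂ] E}
    (h : ∀ a : Fin (n + 1) → S, L (chainPoint a) = M (chainPoint a)) : L = M :=
  toMultilinear_injective <| multilinear_ext fun a => by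
    simpa only [toMultilinear_apply, chainPoint] using h a

theorem exists_clm_chainPoint [CompleteSpace E] {n : ℕ} (φ : (Fin (n + 1) → S) → E) {C : ℝ}
    (hC : 0 ≤ C) (hφ : ∀ a, ‖φ a‖ ≤ C) :
    ∃ L : Chain (Ell1 S) n →L[ℂ] E, ∀ a, L (chainPoint a) = φ a := by
  obtain ⟨Φ, hΦ, -⟩ := exists_multilinear_extending φ hC hφ
  obtain ⟨L, hL⟩ := exists_clm_of_multilinear Φ
  exact ⟨L, fun a => by rw [chainPoint, hL, hΦ]⟩

/-- The inclusion of the finitely supported chains. -/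
noncomputable def realize {n : ℕ} : AlgChain S n →ₗ[ℂ] Chain (Ell1 S) n :=
  Finsupp.linearCombination ℂ chainPoint

theorem realize_single {n : ℕ} (a : Fin (n + 1) → S) :
    realize (Finsupp.single a 1) = chainPoint a := by
  simp [realize]

theorem d_realize {n : ℕ} (z : AlgChain S (n + 1)) :
    d (Ell1 S) n (realize z) = realize (algD S n z) := by
  have : (d (Ell1 S) n).toLinearMap ∘ₗ realize = realize ∘ₗ algD S n := by
    ext a
    simp [realize_single, d_chainPoint, algD_single, -Finsupp.smul_single]
  exact congrArg (fun L => L z) this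

theorem norm_realize_push_le {X : Type*} (f : X → S) {n : ℕ} (z : AlgChain X n) :
    ‖realize (push f n z)‖ ≤ z.sum fun _ c => ‖c‖ := by
  rw [realize, push_apply, Finsupp.linearCombination_mapDomain, Finsupp.linearCombination_apply]
  refine (norm_sum_le _ _).trans (Finset.sum_le_sum fun b _ => ?_)
  rw [norm_smul]
  exact mul_le_of_le_one_right (norm_nonneg _) (norm_chainPoint_le _)

/-! ### The bounded contraction and the vanishing of homology and cohomology -/

open NormalBand

/-- The bound does not depend on `a`, which is what lets the contraction extend to `ℓ¹` chains; the
summand `1` accounts for the single tensor in `rectHomotopy`. -/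
theorem norm_realize_contraction_le (hS : IsNormalBand S) {n : ℕ} (a : Fin (n + 1) → S) :
    ‖realize (contraction hS a)‖ ≤ ((universalChain n).sum fun _ c => ‖c‖) + 1 := by
  rw [contraction, map_add]
  refine (norm_add_le _ _).trans (add_le_add (norm_realize_push_le _ _) ?_)
  rw [rectHomotopy, split, rectSplit, Finsupp.mapDomain_single, realize_single]
  exact norm_chainPoint_le _

/-- The complex of `ℓ¹(S)` has a bounded contraction in positive degrees. -/
theorem exists_contraction (hS : IsNormalBand S) :
    ∃ H : ∀ n, Chain (Ell1 S) n →L[ℂ] Chain (Ell1 S) (n + 1),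
      ∀ n z, d (Ell1 S) (n + 1) (H (n + 1) z) + H n (d (Ell1 S) n z) = z := by
  choose H hH using fun n => exists_clm_chainPoint (fun a : Fin (n + 1) → S =>
    realize (contraction hS a))
    (add_nonneg (Finset.sum_nonneg fun _ _ => norm_nonneg _) zero_le_one)
    (norm_realize_contraction_le hS)
  refine ⟨H, fun n z => ?_⟩
  have : (d (Ell1 S) (n + 1)).comp (H (n + 1)) + (H n).comp (d (Ell1 S) n) =
      ContinuousLinearMap.id ℂ _ := by
    refine clm_ext_chainPoint fun a => ?_
    have e := congrArg realize (algD_contraction hS a)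
    rw [map_add, map_sum, realize_single] at e
    simpa [hH, d_realize, d_chainPoint] using e
  exact congrArg (fun L => L z) this

theorem subsingleton_homology (hS : IsNormalBand S) (n : ℕ) :
    Subsingleton (Homology (Ell1 S) (n + 1)) := by
  obtain ⟨H, hH⟩ := exists_contraction hS
  rw [Submodule.Quotient.subsingleton_iff, Submodule.submoduleOf, Submodule.comap_subtype_eq_top]
  intro z hz
  have hz' : d (Ell1 S) n z = 0 := hz
  refine ⟨H (n + 1) z, ?_⟩
  have := hH n z
  rwa [hz', map_zero, add_zero] at this

theorem subsingleton_cohomology (hS : IsNormalBand S) (n : ℕ) :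
    Subsingleton (Cohomology (Ell1 S) (n + 1)) := by
  obtain ⟨H, hH⟩ := exists_contraction hS
  rw [Submodule.Quotient.subsingleton_iff, Submodule.submoduleOf, Submodule.comap_subtype_eq_top]
  intro T hT
  have hT' : ∀ a x, coboundary T a x = 0 := hT
  -- The argument of the functional becomes the entry of index `0`, as in `coboundary_eq_sum`.
  let Φ : ContinuousMultilinearMap ℂ (fun _ : Fin (n + 2) => Ell1 S) ℂ :=
    ContinuousLinearMap.uncurryLeft (Ei := fun _ => Ell1 S) T.flipLinear
  obtain ⟨τ, hτ⟩ := exists_clm_of_multilinear Φ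
  have hτ' : ∀ a, τ (elementary a) = T (Fin.tail a) (a 0) := fun a => hτ a
  have hd : τ.comp (d (Ell1 S) (n + 1)) = 0 := by
    refine toMultilinear_injective ?_
    ext b
    have := hT' (Fin.tail b) (b 0)
    rw [coboundary_eq_sum, Fin.cons_self_tail] at this
    simpa [toMultilinear_apply, d_elementary, hτ'] using this
  -- The witness is `τ ∘ H n`: its coboundary is `τ H d = τ - τ d H = τ`, since `τ d = 0`.
  refine ⟨(toMultilinear (τ.comp (H n))).curryLeft.flipMultilinear, fun a x => ?_⟩
  have hU : ∀ (b : Fin n → Ell1 S) (y : Ell1 S),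
      (toMultilinear (τ.comp (H n))).curryLeft.flipMultilinear b y =
        τ (H n (elementary (Fin.cons y b))) := fun b y => by
    simp [toMultilinear_apply]
  have e := congrArg τ (hH n (elementary (Fin.cons x a)))
  have e' : τ (d (Ell1 S) (n + 1) (H (n + 1) (elementary (Fin.cons x a)))) = 0 :=
    congrArg (fun L => L (H (n + 1) (elementary (Fin.cons x a)))) hd
  rw [map_add, e', zero_add, hτ', Fin.cons_zero, Fin.tail_cons] at e
  rw [coboundary_eq_sum, ← e]
  simp only [hU, Fin.cons_self_tail]
  simp [d_elementary]

end Ell1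

end Hochschild

theorem mainTheorem5 (S : Type u) [Semigroup S] (hS : IsNormalBand S) :
    Hochschild.SimpliciallyTrivial (Ell1 S) := by
  intro n hn
  obtain ⟨m, rfl⟩ := Nat.exists_eq_add_of_le' hn
  exact ⟨Hochschild.subsingleton_homology hS m, Hochschild.subsingleton_cohomology hS m⟩
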